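/- All trees are finite. A \emph{leaf} is a vertex of degree $1$; a \emph{$1$-$3$ tree} is a tree in which every vertex has degree $1$ or $3$; a tree is \emph{even} if all of its leaves lie in the same class of its unique bipartition. A \emph{leaf-leaf path} is a path whose two ends are leaves (a single leaf counts as a leaf-leaf path of length $0$), and its length is its number of edges. Then: (i) There is an integer $N_0$ such that every even $1$-$3$ tree $T$ with at least $N_0$ vertices contains leaf-leaf paths of each of the lengths $0, 2, 4, \dots, 18$. (ii) There is an infinite family $(T_n)_{n=1}^{\infty}$ of even $1$-$3$ trees, with $|V(T_1)| < |V(T_2)| < \cdots$, such that no $T_n$ contains a leaf-leaf path of length $20$. -/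

import Mathlib

namespace SimpleGraph

variable {V : Type*} (G : SimpleGraph V)

/-- A leaf is a vertex of degree `1`. -/
def IsLeafVertex [G.LocallyFinite] (v : V) : Prop :=
  G.degree v = 1

/-- All leaves lie in the same class of a bipartition of `G`. A tree has exactly one bipartition
(up to exchanging the two classes), so for trees this says that the leaves lie in the same class of
that bipartition. -/
def LeavesInOneClass [G.LocallyFinite] : Prop :=
  ∃ c : G.Coloring Bool, ∀ u v : V, G.IsLeafVertex u → G.IsLeafVertex v → c u = c v

/-- An even 1-3 tree: a tree in which every vertex has degree `1` or `3` and all leaves lie in the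
same class of the bipartition. -/
structure IsEvenOneThreeTree [G.LocallyFinite] : Prop where
  isTree : G.IsTree
  degree_eq : ∀ v : V, G.degree v = 1 ∨ G.degree v = 3
  even : G.LeavesInOneClass

/-- `G` contains a leaf-leaf path with exactly `ℓ` edges. The two end leaves may coincide, in which
case the path is trivial and `ℓ = 0`. -/
def HasLeafLeafPath [G.LocallyFinite] (ℓ : ℕ) : Prop :=
  ∃ (u v : V) (p : G.Walk u v),
    G.IsLeafVertex u ∧ G.IsLeafVertex v ∧ p.IsPath ∧ p.length = ℓ

end SimpleGraph

open SimpleGraph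

/-!
Suppose that a tree without vertices of degree `2` has no leaf-leaf path of length `2 * m`. Then
beyond every edge `uv` there is a leaf at distance less than `m` from `v`: inductively, two branches
at `v` have leaves at distances `i, j ≤ m` from `v`, and `i + j ≠ 2 * m`, so `i` or `j` is less than
`m`. Hence off the `t`-th vertex of a leaf-leaf path hangs a leaf at some distance `k t ≤ m`, and
`k s + k t + (t - s) ≠ 2 * m` for `s < t` because this is the distance between the chosen leaves.
In an even tree `t + k t` is even as well. A finite computation shows that such a sequence `k` has
at most `60` steps when `m ≤ 9`, whereas a tree with bounded degrees and many vertices has a long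
leaf-leaf path.

For `m = 10` there are arbitrarily long sequences `k`, with period `24`. Hanging perfect binary
trees off a path, with their leaves at distances `k t` from it, turns such a sequence into an even
1-3 tree without leaf-leaf paths of length `20`: two leaves of the same binary tree are less than
`20` apart, and all other distances between leaves are of the form `k s + k t + (t - s)`.
-/

section Profile

/-- The numbers `k 0, …, k n` are admissible as heights along a leaf-leaf path `p` with `n` edges in
an even tree without leaf-leaf paths of length `2 * m`: a leaf hangs off the `t`-th vertex of `p` at
distance `k t`, the ends of `p` being the leaves of height `0`. -/
structure IsSpineProfile (m n : ℕ) (k : ℕ → ℕ) : Prop where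
  eq_zero_iff : ∀ t ≤ n, k t = 0 ↔ t = 0 ∨ t = n
  le : ∀ t ≤ n, k t ≤ m
  even : ∀ t ≤ n, Even (t + k t)
  add_ne : ∀ s t, s < t → t ≤ n → k s + k t + (t - s) ≠ 2 * m

theorem exists_mem_pwFilter_not {α : Type*} {r : α → α → Prop} [IsPreorder α r] [DecidableRel r]
    {l : List α} {a : α} (ha : a ∈ l) : ∃ b ∈ l.pwFilter fun x y => ¬ r y x, r b a := by
  by_contra! h
  refine (List.forall_mem_pwFilter (fun {x y z} hzx => ?_) a l).1 h a ha (refl a)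
  by_contra! hyx
  exact hzx (_root_.trans hyx.2 hyx.1)

/-- The possible sets of remaining distances in spine profiles after position `t`, inclusion-minimal
ones only. A set is encoded by its characteristic bits: bit `d` of a state stands for a height `k s`
with `s ≤ t` and `k s + (t + 1 - s) = d`, so that position `t + 1` cannot have height
`2 * m - d`. -/
def spineStates (m : ℕ) : ℕ → List ℕ
  | 0 => [2]
  | t + 1 => ((spineStates m t).flatMap fun S =>
      ((List.range' 1 m).filter fun j => (t + 1 + j) % 2 == 0 && !S.testBit (2 * m - j)).map
        fun j => ((S ||| 1 <<< j) <<< 1) % 2 ^ (2 * m)).pwFilter fun S S' => ¬ S' &&& S = S'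

theorem spineStates_sixty : ∀ m ≤ 9, spineStates m 60 = [] := by
  decide +kernel

theorem exists_mem_spineStates_succ {m t S j : ℕ} (hS : S ∈ spineStates m t) (hj : 0 < j)
    (hjm : j ≤ m) (heven : Even (t + 1 + j)) (hfree : S.testBit (2 * m - j) = false) :
    ∃ S' ∈ spineStates m (t + 1), ∀ d, S'.testBit d → 0 < d ∧ (S.testBit (d - 1) ∨ d - 1 = j) := by
  have hstep : ((S ||| 1 <<< j) <<< 1) % 2 ^ (2 * m) ∈ (spineStates m t).flatMap fun S =>
      ((List.range' 1 m).filter fun j => (t + 1 + j) % 2 == 0 && !S.testBit (2 * m - j)).map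
        fun j => ((S ||| 1 <<< j) <<< 1) % 2 ^ (2 * m) := by
    refine List.mem_flatMap.2 ⟨S, hS, List.mem_map.2 ⟨j, List.mem_filter.2 ⟨?_, ?_⟩, rfl⟩⟩
    · exact List.mem_range'_1.2 ⟨hj, by omega⟩
    · simp [Nat.even_iff.1 heven, hfree]
  have : IsPreorder ℕ fun S S' => S &&& S' = S :=
    { refl := Nat.and_self, trans := fun _ _ _ h h' => by rw [← h, Nat.and_assoc, h'] }
  obtain ⟨S', hS', hsub⟩ := exists_mem_pwFilter_not (r := fun S S' : ℕ => S &&& S' = S) hstep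
  refine ⟨S', hS', fun d hd => ?_⟩
  have hd' : (((S ||| 1 <<< j) <<< 1) % 2 ^ (2 * m)).testBit d := by
    rw [← hsub, Nat.testBit_and, Bool.and_eq_true] at hd
    exact hd.2
  simp only [Nat.testBit_mod_two_pow, Nat.testBit_shiftLeft, Nat.testBit_or, Nat.one_shiftLeft,
    Nat.testBit_two_pow, ge_iff_le, Bool.and_eq_true, Bool.or_eq_true, decide_eq_true_eq] at hd'
  exact ⟨hd'.2.1, hd'.2.2.imp_right Eq.symm⟩

theorem IsSpineProfile.exists_mem_spineStates {m n : ℕ} {k : ℕ → ℕ} (hk : IsSpineProfile m n k)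
    {t : ℕ} (ht : t < n) :
    ∃ S ∈ spineStates m t, ∀ d, S.testBit d → ∃ s ≤ t, k s + (t + 1 - s) = d := by
  induction t with
  | zero =>
    refine ⟨2, List.mem_singleton_self 2, fun d hd => ⟨0, le_rfl, ?_⟩⟩
    rw [← pow_one 2, Nat.testBit_two_pow, decide_eq_true_eq] at hd
    rw [(hk.eq_zero_iff 0 (by omega)).2 (Or.inl rfl), ← hd]
  | succ t ih =>
    obtain ⟨S, hS, hSk⟩ := ih (by omega)
    have hpos : k (t + 1) ≠ 0 := by
      rw [Ne, hk.eq_zero_iff _ ht.le]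
      omega
    have hle := hk.le _ ht.le
    have hfree : S.testBit (2 * m - k (t + 1)) = false := by
      by_contra hbit
      obtain ⟨s, hs, hsd⟩ := hSk _ (by simpa using hbit)
      exact hk.add_ne s (t + 1) (by omega) ht.le (by omega)
    obtain ⟨S', hS', hbits⟩ := exists_mem_spineStates_succ hS (Nat.pos_of_ne_zero hpos) hle
      (hk.even _ ht.le) hfree
    refine ⟨S', hS', fun d hd => ?_⟩
    obtain ⟨hd0, hd | hd⟩ := hbits d hd
    · obtain ⟨s, hs, hsd⟩ := hSk _ hd
      exact ⟨s, by omega, by omega⟩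
    · exact ⟨t + 1, le_rfl, by omega⟩

theorem IsSpineProfile.le_sixty {m n : ℕ} {k : ℕ → ℕ} (hk : IsSpineProfile m n k) (hm : m ≤ 9) :
    n ≤ 60 := by
  by_contra! hn
  obtain ⟨S, hS, -⟩ := hk.exists_mem_spineStates hn
  rw [spineStates_sixty m hm] at hS
  exact List.not_mem_nil hS

end Profile

section Acyclic

variable {V : Type*} {G : SimpleGraph V}

theorem isPath_append (hG : G.IsAcyclic) {x y z : V} {p : G.Walk x y} {q : G.Walk y z}
    (hp : p.IsPath) (hq : q.IsPath) (h : p.penultimate ≠ q.snd) : (p.append q).IsPath := by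
  rw [hG.isPath_iff_isChain] at hp hq ⊢
  rw [Walk.edges_append, List.isChain_append]
  refine ⟨hp, hq, fun e he e' he' hee' => h ?_⟩
  rwa [← List.getLast_of_mem_getLast? he, ← List.head_of_mem_head? he',
    Walk.getLast_edges_eq_mk_penultimate_end, Walk.head_edges_eq_mk_start_snd, Sym2.eq_swap,
    Sym2.congr_right] at hee'

theorem length_le_of_isPath (hG : G.IsAcyclic) {x y : V} {p : G.Walk x y} (hp : p.IsPath)
    (q : G.Walk x y) : p.length ≤ q.length := by
  classical
  have hpq : p = q.bypass :=
    congrArg Subtype.val ((hG.subsingleton_path x y).elim ⟨p, hp⟩ q.toPath)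
  exact hpq ▸ q.length_bypass_le_length

theorem dart_induction [Finite V] (hG : G.IsAcyclic) {P : V → V → Prop}
    (hP : ∀ u v, G.Adj u v → (∀ w, G.Adj v w → w ≠ u → P v w) → P u v) {u v : V}
    (h : G.Adj u v) : P u v := by
  have := Fintype.ofFinite V
  suffices key : ∀ (n : ℕ) (r u v : V) (q : G.Walk r u) (h : G.Adj u v), (q.concat h).IsPath →
      Fintype.card V ≤ n + q.length → P u v from
    key (Fintype.card V) u u v Walk.nil h (by simpa [Walk.concat] using h.ne) (by simp)
  intro n
  induction n with
  | zero =>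
    intro r u v q h hp hcard
    have := hp.length_lt
    rw [Walk.length_concat] at this
    omega
  | succ n ih =>
    intro r u v q h hp hcard
    refine hP u v h fun w hvw hwu => ih r v w (q.concat h) hvw (hp.concat (fun hw => hwu ?_) hvw) ?_
    · simpa using hG.eq_penultimate_of_adj_end hp hvw hw
    · rw [Walk.length_concat]
      omega

end Acyclic

section LeafAvoiding

variable {V : Type*} {G : SimpleGraph V} [G.LocallyFinite]

variable (G) in
/-- Some leaf is joined to `v` by a path of length `k` whose first step does not enter `A`. If `v`
is itself a leaf, the trivial path qualifies with `k = 0` as soon as `v ∉ A`, because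
`Walk.nil.snd = v`. -/
def HasLeafAvoiding (A : Set V) (v : V) (k : ℕ) : Prop :=
  ∃ (w : V) (q : G.Walk v w), G.IsLeafVertex w ∧ q.IsPath ∧ q.snd ∉ A ∧ q.length = k

theorem HasLeafAvoiding.mono {A B : Set V} (hBA : B ⊆ A) {v : V} {k : ℕ}
    (h : HasLeafAvoiding G A v k) : HasLeafAvoiding G B v k := by
  obtain ⟨w, q, hw, hq, hqA, hqk⟩ := h
  exact ⟨w, q, hw, hq, fun hqB => hqA (hBA hqB), hqk⟩

theorem HasLeafAvoiding.cons (hG : G.IsAcyclic) {A : Set V} {v a : V} {k : ℕ} (hva : G.Adj v a)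
    (ha : a ∉ A) (h : HasLeafAvoiding G {v} a k) : HasLeafAvoiding G A v (k + 1) := by
  obtain ⟨w, q, hw, hq, hqv, rfl⟩ := h
  refine ⟨w, Walk.cons hva q, hw, hq.cons fun hv => hqv ?_, by simpa using ha, rfl⟩
  exact (hG.eq_snd_of_adj_start hq hva.symm hv).symm

theorem HasLeafAvoiding.hasLeafLeafPath (hG : G.IsAcyclic) {x y : V} {p : G.Walk x y}
    (hp : p.IsPath) (hxy : ¬ p.Nil) {i j : ℕ} (hi : HasLeafAvoiding G {p.snd} x i)
    (hj : HasLeafAvoiding G {p.penultimate} y j) : G.HasLeafLeafPath (i + p.length + j) := by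
  obtain ⟨v, q, hv, hq, hqp, rfl⟩ := hi
  obtain ⟨w, r, hw, hr, hrp, rfl⟩ := hj
  have hpr : (p.append r).IsPath := isPath_append hG hp hr (Ne.symm hrp)
  have hsnd : (p.append r).snd = p.snd :=
    (Walk.getVert_append' p r 1).trans (if_pos (Walk.not_nil_iff_lt_length.1 hxy))
  have hqpr : (q.reverse.append (p.append r)).IsPath :=
    isPath_append hG hq.reverse hpr (by rwa [Walk.penultimate_reverse, hsnd])
  exact ⟨v, w, _, hv, hw, hqpr, by simp only [Walk.length_append, Walk.length_reverse]; omega⟩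

end LeafAvoiding

section LeafLeafPaths

variable {V : Type*} {G : SimpleGraph V} [G.LocallyFinite]

theorem exists_adj_notMem {v : V} {A : Set V} (hA : A.ncard < G.degree v)
    (hfin : A.Finite := by toFinite_tac) : ∃ a, G.Adj v a ∧ a ∉ A := by
  rw [← card_neighborSet_eq_degree, ← Nat.card_eq_fintype_card, Nat.card_coe_set_eq] at hA
  exact Set.exists_mem_notMem_of_ncard_lt_ncard hA hfin

theorem exists_hasLeafAvoiding_singleton_lt [Finite V] (hG : G.IsAcyclic)
    (hdeg : ∀ v, G.degree v ≠ 2) {m : ℕ} (hm : 0 < m) (hno : ¬ G.HasLeafLeafPath (2 * m)) {u v : V}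
    (huv : G.Adj u v) : ∃ j < m, HasLeafAvoiding G {u} v j := by
  refine dart_induction hG (P := fun u v => ∃ j < m, HasLeafAvoiding G {u} v j) ?_ huv
  intro u v huv ih
  by_cases hv : G.IsLeafVertex v
  · exact ⟨0, hm, v, Walk.nil, hv, Walk.IsPath.nil, huv.ne', rfl⟩
  have hv3 : 2 < G.degree v := by
    have := huv.symm.degree_pos_left
    have := hdeg v
    unfold IsLeafVertex at hv
    omega
  obtain ⟨a, hva, hau⟩ : ∃ a, G.Adj v a ∧ a ∉ ({u} : Set V) :=
    exists_adj_notMem (by rw [Set.ncard_singleton]; omega)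
  obtain ⟨b, hvb, hb⟩ : ∃ b, G.Adj v b ∧ b ∉ ({u, a} : Set V) :=
    exists_adj_notMem ((Set.ncard_insert_le _ _).trans_lt (by rwa [Set.ncard_singleton]))
  obtain ⟨hbu, hba⟩ : b ≠ u ∧ b ≠ a := by simpa using hb
  obtain ⟨i, hi, hia⟩ := ih a hva hau
  obtain ⟨j, hj, hjb⟩ := ih b hvb hbu
  have havb : (Walk.cons hva.symm (Walk.cons hvb Walk.nil)).IsPath := by
    simp [hva.ne', hvb.ne, hba.symm]
  have hij : i + 2 + j ≠ 2 * m := fun h =>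
    hno (h ▸ hia.hasLeafLeafPath hG havb Walk.not_nil_cons hjb)
  rcases lt_or_ge (i + 1) m with hi' | hi'
  · exact ⟨i + 1, hi', hia.cons hG hva hau⟩
  · exact ⟨j + 1, by omega, hjb.cons hG hvb hbu⟩

theorem even_length_of_leavesInOneClass (hG : G.LeavesInOneClass) {u v : V} (hu : G.IsLeafVertex u)
    (hv : G.IsLeafVertex v) (p : G.Walk u v) : Even p.length := by
  obtain ⟨c, hc⟩ := hG
  rw [c.even_length_iff_congr p, hc u v hu hv]

section Spine

variable {u v : V} {p : G.Walk u v}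

theorem exists_hasLeafAvoiding_neighborSet [Finite V] (hG : G.IsAcyclic)
    (hdeg : ∀ v, G.degree v ≠ 2) {m : ℕ} (hm : 0 < m) (hno : ¬ G.HasLeafLeafPath (2 * m))
    (hu : G.IsLeafVertex u) (hv : G.IsLeafVertex v) (hp : p.IsPath) {t : ℕ} (ht : t ≤ p.length) :
    ∃ k ≤ m, (k = 0 ↔ t = 0 ∨ t = p.length) ∧
      HasLeafAvoiding G (p.toSubgraph.neighborSet (p.getVert t)) (p.getVert t) k := by
  have hnil : ∀ x, G.IsLeafVertex x → HasLeafAvoiding G (p.toSubgraph.neighborSet x) x 0 :=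
    fun x hx => ⟨x, Walk.nil, hx, Walk.IsPath.nil, p.toSubgraph.loopless.irrefl x, rfl⟩
  by_cases hend : t = 0 ∨ t = p.length
  · refine ⟨0, m.zero_le, by simp [hend], hnil _ ?_⟩
    rcases hend with rfl | rfl
    · rwa [Walk.getVert_zero]
    · rwa [Walk.getVert_length]
  push Not at hend
  have htwo := hp.ncard_neighborSet_toSubgraph_internal_eq_two hend.1 (by omega)
  have hle : 2 ≤ G.degree (p.getVert t) := by
    rw [← htwo, ← card_neighborSet_eq_degree, ← Nat.card_eq_fintype_card, Nat.card_coe_set_eq]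
    exact Set.ncard_le_ncard (p.toSubgraph.neighborSet_subset _)
  obtain ⟨a, hta, ha⟩ := exists_adj_notMem (htwo.trans_lt (lt_of_le_of_ne hle (hdeg _).symm))
  obtain ⟨j, hj, hja⟩ := exists_hasLeafAvoiding_singleton_lt hG hdeg hm hno hta
  exact ⟨j + 1, hj, by omega, hja.cons hG hta ha⟩

theorem hasLeafLeafPath_of_hasLeafAvoiding_getVert (hG : G.IsAcyclic) (hp : p.IsPath) {s t i j : ℕ}
    (hst : s < t) (ht : t ≤ p.length)
    (hi : HasLeafAvoiding G (p.toSubgraph.neighborSet (p.getVert s)) (p.getVert s) i)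
    (hj : HasLeafAvoiding G (p.toSubgraph.neighborSet (p.getVert t)) (p.getVert t) j) :
    G.HasLeafLeafPath (i + j + (t - s)) := by
  have hend : (p.drop s).getVert (t - s) = p.getVert t := by
    rw [Walk.drop_getVert, Nat.add_sub_cancel' hst.le]
  set q := (p.drop s).take (t - s) with hq
  have hlen : q.length = t - s := by
    rw [hq, Walk.take_length, Walk.drop_length]
    omega
  have hvert : ∀ r ≤ t - s, q.getVert r = p.getVert (s + r) := fun r hr => by
    rw [hq, Walk.take_getVert, Walk.drop_getVert, min_eq_right hr]
  have hsnd : q.snd ∈ p.toSubgraph.neighborSet (p.getVert s) := by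
    rw [Walk.snd, hvert 1 (by omega)]
    exact p.toSubgraph_adj_getVert (hst.trans_le ht)
  have hpen : q.penultimate ∈ p.toSubgraph.neighborSet (p.getVert t) := by
    rw [Walk.penultimate, hlen, hvert (t - s - 1) (by omega)]
    have hadj := p.toSubgraph_adj_getVert (i := t - 1) (by omega)
    rw [show t - 1 + 1 = t by omega] at hadj
    rw [show s + (t - s - 1) = t - 1 by omega]
    exact hadj.symm
  rw [← hend] at hj hpen
  have hnil : ¬ q.Nil := by
    rw [Walk.not_nil_iff_lt_length, hlen]
    omega
  have hpath := (hi.mono (Set.singleton_subset_iff.2 hsnd)).hasLeafLeafPath hG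
    ((hp.drop s).take (t - s)) hnil (hj.mono (Set.singleton_subset_iff.2 hpen))
  rwa [hlen, Nat.add_right_comm] at hpath

theorem exists_isSpineProfile [Finite V] (hG : G.IsAcyclic) (hdeg : ∀ v, G.degree v ≠ 2)
    (hone : G.LeavesInOneClass) {m n : ℕ} (hm : 0 < m) (hno : ¬ G.HasLeafLeafPath (2 * m))
    (hn : G.HasLeafLeafPath n) : ∃ k, IsSpineProfile m n k := by
  obtain ⟨u, v, p, hu, hv, hp, rfl⟩ := hn
  choose! k hkm hk0 hk using fun (t : ℕ) (ht : t ≤ p.length) =>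
    exists_hasLeafAvoiding_neighborSet hG hdeg hm hno hu hv hp ht
  refine ⟨k, hk0, hkm, fun t ht => ?_, fun s t hst ht h => hno ?_⟩
  · obtain ⟨w, q, hw, -, -, hqk⟩ := hk t ht
    have := even_length_of_leavesInOneClass hone hu hw ((p.take t).append q)
    rwa [Walk.length_append, Walk.take_length, min_eq_left ht, hqk] at this
  · exact h ▸ hasLeafLeafPath_of_hasLeafAvoiding_getVert hG hp hst ht (hk s (by omega)) (hk t ht)

end Spine

theorem exists_le_hasLeafLeafPath [Finite V] (hG : G.IsAcyclic) {x y : V} {q : G.Walk x y}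
    (hq : q.IsPath) (hxy : ¬ q.Nil) : ∃ n, q.length ≤ n ∧ G.HasLeafLeafPath n := by
  have : Nonempty V := ⟨x⟩
  have : Finite G.edgeSet := Subtype.finite
  obtain ⟨u, v, p, hp, hmax⟩ := Walk.exists_isPath_forall_isPath_length_le_length G
  have hqp := hmax x y q hq
  have hnil : ¬ p.Nil := by
    rw [Walk.not_nil_iff_lt_length] at hxy ⊢
    omega
  refine ⟨p.length, hqp, u, v, p, ?_, ?_, hp, rfl⟩ <;>
    rw [IsLeafVertex, degree_eq_one_iff_existsUnique_adj]
  · refine ⟨p.snd, p.adj_snd hnil, fun w huw => hG.eq_snd_of_adj_start hp huw ?_⟩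
    by_contra hw
    exact (hmax _ _ _ (hp.cons (h := huw.symm) hw)).not_gt (by simp)
  · refine ⟨p.penultimate, (p.adj_penultimate hnil).symm, fun w hvw =>
      hG.eq_penultimate_of_adj_end hp hvw ?_⟩
    by_contra hw
    exact (hmax _ _ _ (hp.concat hw hvw)).not_gt (by simp)

theorem card_dist_le [Fintype V] (hG : G.Connected) {d : ℕ} (hdeg : ∀ v, G.degree v ≤ d) (r : V)
    (n : ℕ) : (Finset.univ.filter fun v => G.dist r v ≤ n).card ≤ (d + 1) ^ n := by
  classical
  induction n with
  | zero => simp [hG.dist_eq_zero_iff, Finset.filter_eq]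
  | succ n ih =>
    have hsub : (Finset.univ.filter fun v => G.dist r v ≤ n + 1) ⊆
        (Finset.univ.filter fun v => G.dist r v ≤ n).biUnion
          fun v => insert v (G.neighborFinset v) := by
      intro v hv
      simp only [Finset.mem_filter, Finset.mem_univ, true_and, Finset.mem_biUnion,
        Finset.mem_insert, mem_neighborFinset] at hv ⊢
      obtain ⟨p, hp⟩ := hG.exists_walk_length_eq_dist v r
      cases p with
      | nil => exact ⟨r, by simp, Or.inl rfl⟩
      | @cons _ a _ h p =>
        refine ⟨a, ?_, Or.inr h.symm⟩
        rw [dist_comm, ← hp, Walk.length_cons] at hv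
        rw [dist_comm]
        exact (dist_le p).trans (by omega)
    calc (Finset.univ.filter fun v => G.dist r v ≤ n + 1).card
      _ ≤ _ := Finset.card_le_card hsub
      _ ≤ (Finset.univ.filter fun v => G.dist r v ≤ n).card * (d + 1) :=
        Finset.card_biUnion_le_card_mul _ _ _ fun v _ => (Finset.card_insert_le _ _).trans
          (Nat.succ_le_succ (hdeg v))
      _ ≤ (d + 1) ^ (n + 1) := by
        rw [pow_succ]
        gcongr

theorem exists_lt_hasLeafLeafPath [Fintype V] (hG : G.IsTree) {d : ℕ} (hdeg : ∀ v, G.degree v ≤ d)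
    {n : ℕ} (hcard : (d + 1) ^ n < Fintype.card V) : ∃ l, n < l ∧ G.HasLeafLeafPath l := by
  obtain ⟨r⟩ := hG.connected.nonempty
  obtain ⟨x, hx⟩ : ∃ x, n < G.dist r x := by
    by_contra! hall
    have := card_dist_le hG.connected hdeg r n
    rw [Finset.filter_true_of_mem fun v _ => hall v, Finset.card_univ] at this
    omega
  obtain ⟨p, hp, hpx⟩ := hG.connected.exists_path_of_dist r x
  obtain ⟨l, hl, h⟩ := exists_le_hasLeafLeafPath hG.isAcyclic hp
    (by rw [Walk.not_nil_iff_lt_length]; omega)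
  exact ⟨l, by omega, h⟩

theorem hasLeafLeafPath_two_mul_of_le_nine [Fintype V] (hG : G.IsTree) {d : ℕ}
    (hdeg : ∀ v, G.degree v ≠ 2) (hd : ∀ v, G.degree v ≤ d) (hone : G.LeavesInOneClass)
    (hcard : (d + 1) ^ 60 < Fintype.card V) {m : ℕ} (hm : m ≤ 9) : G.HasLeafLeafPath (2 * m) := by
  obtain ⟨n, hn, hpath⟩ := exists_lt_hasLeafLeafPath hG hd hcard
  rcases Nat.eq_zero_or_pos m with rfl | hm0
  · obtain ⟨u, -, -, hu, -⟩ := hpath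
    exact ⟨u, u, Walk.nil, hu, hu, Walk.IsPath.nil, rfl⟩
  · by_contra hno
    obtain ⟨k, hk⟩ := exists_isSpineProfile hG.isAcyclic hdeg hone hm0 hno hpath
    exact (hk.le_sixty hm).not_gt hn

end LeafLeafPaths

section ParentGraph

variable {V : Type*} {par : V → V}

/-- The graph in which every vertex `x` is joined to its parent `par x`; the roots are the fixed
points of `par`. -/
def parentGraph (par : V → V) : SimpleGraph V :=
  SimpleGraph.fromRel fun x y => par x = y

theorem isAcyclic_parentGraph {level : V → ℕ} (hlevel : ∀ x, par x ≠ x → level (par x) < level x) :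
    (parentGraph par).IsAcyclic := by
  classical
  intro v c hc
  obtain ⟨x, hx, hmax⟩ := c.support.toFinset.exists_max_image level ⟨v, by simp⟩
  have hx : x ∈ c.support := by simpa using hx
  have hparent : ∀ y ∈ c.support, (parentGraph par).Adj x y → y = par x := by
    rintro y hy ⟨hxy, rfl | rfl⟩
    · rfl
    · exact absurd (hlevel y hxy) (hmax y (by simpa using hy)).not_gt
  have hc' := hc.rotate hx
  refine hc'.snd_ne_penultimate ((hparent _ ?_ ((c.rotate x hx).adj_snd hc'.not_nil)).trans
    (hparent _ ?_ ((c.rotate x hx).adj_penultimate hc'.not_nil).symm).symm)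
  · exact (c.mem_support_rotate_iff x hx).1 (Walk.getVert_mem_support _ _)
  · exact (c.mem_support_rotate_iff x hx).1 (Walk.getVert_mem_support _ _)

theorem connected_induce_parentGraph {level : V → ℕ}
    (hlevel : ∀ x, par x ≠ x → level (par x) < level x) {s : Set V} {r : V} (hr : r ∈ s)
    (hs : ∀ x ∈ s, par x ∈ s) (hroot : ∀ x ∈ s, par x = x → x = r) :
    ((parentGraph par).induce s).Connected := by
  have hreach : ∀ (l : ℕ) (x : s), level x = l →
      ((parentGraph par).induce s).Reachable x ⟨r, hr⟩ := by
    intro l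
    induction l using Nat.strong_induction_on with
    | _ l ih =>
      rintro x rfl
      by_cases hx : par x = x
      · obtain rfl : x = ⟨r, hr⟩ := Subtype.ext (hroot x x.2 hx)
        rfl
      · have hadj : ((parentGraph par).induce s).Adj x ⟨par x, hs x x.2⟩ := ⟨Ne.symm hx, Or.inl rfl⟩
        exact hadj.reachable.trans (ih _ (hlevel x hx) _ rfl)
  have : Nonempty s := ⟨⟨r, hr⟩⟩
  exact ⟨fun x y => (hreach _ x rfl).trans (hreach _ y rfl).symm⟩

theorem exists_isPath_iterate_parent {level : V → ℕ}
    (hlevel : ∀ x, par x ≠ x → level (par x) < level x) {x : V} {l : ℕ}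
    (hx : ∀ j < l, par (par^[j] x) ≠ par^[j] x) :
    ∃ p : (parentGraph par).Walk x (par^[l] x),
      p.IsPath ∧ p.length = l ∧ p.penultimate = par^[l - 1] x := by
  induction l with
  | zero => exact ⟨Walk.nil, Walk.IsPath.nil, rfl, rfl⟩
  | succ l ih =>
    obtain ⟨p, hp, hpl, hpen⟩ := ih fun j hj => hx j (by omega)
    rw [Function.iterate_succ_apply']
    have hadj : (parentGraph par).Adj (par^[l] x) (par (par^[l] x)) :=
      ⟨(hx l (by omega)).symm, Or.inl rfl⟩
    have hne : p.penultimate ≠ par (par^[l] x) := by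
      rw [hpen]
      have hlt := hlevel _ (hx l (by omega))
      rcases l with - | l
      · exact (hx 0 (by omega)).symm
      · have hlt' := hlevel _ (hx l (by omega))
        rw [← Function.iterate_succ_apply' par] at hlt'
        exact fun h => (hlt.trans hlt').ne' (congrArg level h)
    refine ⟨p.concat hadj, ?_, by rw [Walk.length_concat, hpl], p.penultimate_concat hadj⟩
    rw [Walk.concat_eq_append]
    exact isPath_append (isAcyclic_parentGraph hlevel) hp (Path.singleton hadj).2 hne

end ParentGraph

section Induce

variable {V : Type*} {G : SimpleGraph V} {s : Set V}

theorem degree_induce_eq_card [(G.induce s).LocallyFinite] {x : V} (hx : x ∈ s) {F : Finset V}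
    (hF : ∀ y, y ∈ F ↔ y ∈ s ∧ G.Adj x y) : (G.induce s).degree ⟨x, hx⟩ = F.card := by
  have himage : Subtype.val '' (G.induce s).neighborSet ⟨x, hx⟩ = F := by
    ext y
    simp [hF, and_comm]
  rw [← card_neighborSet_eq_degree, ← Nat.card_eq_fintype_card, Nat.card_coe_set_eq,
    ← Set.ncard_image_of_injective _ Subtype.val_injective, himage, Set.ncard_coe_finset]

end Induce

section ParentGraphPaths

variable {V : Type*} {par : V → V} {level : V → ℕ}

theorem length_le_of_iterate_parent_eq (hlevel : ∀ x, par x ≠ x → level (par x) < level x)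
    {x y : V} {a b : ℕ} (hx : ∀ j < a, par (par^[j] x) ≠ par^[j] x)
    (hy : ∀ j < b, par (par^[j] y) ≠ par^[j] y) (hxy : par^[a] x = par^[b] y)
    {p : (parentGraph par).Walk x y} (hp : p.IsPath) : p.length ≤ a + b := by
  obtain ⟨q, -, hq, -⟩ := exists_isPath_iterate_parent hlevel hx
  obtain ⟨r, -, hr, -⟩ := exists_isPath_iterate_parent hlevel hy
  have := length_le_of_isPath (isAcyclic_parentGraph hlevel) hp
    (q.append (r.copy rfl hxy.symm).reverse)
  rwa [Walk.length_append, Walk.length_reverse, Walk.length_copy, hq, hr] at this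

theorem length_eq_of_iterate_parent_eq (hlevel : ∀ x, par x ≠ x → level (par x) < level x)
    {x y : V} {a b : ℕ} (hx : ∀ j < a, par (par^[j] x) ≠ par^[j] x)
    (hy : ∀ j < b, par (par^[j] y) ≠ par^[j] y) (hxy : par^[a] x = par^[b] y)
    (hne : par^[a - 1] x ≠ par^[b - 1] y) {p : (parentGraph par).Walk x y} (hp : p.IsPath) :
    p.length = a + b := by
  have hG := isAcyclic_parentGraph hlevel
  refine le_antisymm (length_le_of_iterate_parent_eq hlevel hx hy hxy hp) ?_
  obtain ⟨q, hqp, hq, hqpen⟩ := exists_isPath_iterate_parent hlevel hx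
  obtain ⟨r, hrp, hr, hrpen⟩ := exists_isPath_iterate_parent hlevel hy
  rw [← hqpen, ← hrpen] at hne
  generalize par^[a] x = z at q hxy
  subst hxy
  have := length_le_of_isPath hG (isPath_append hG hqp hrp.reverse (by rwa [Walk.snd_reverse])) p
  rwa [Walk.length_append, Walk.length_reverse, hq, hr] at this

end ParentGraphPaths

section Caterpillar

theorem size_div_two_pow (i a : ℕ) : (i / 2 ^ a).size = i.size - a := by
  refine eq_of_forall_ge_iff fun m => ?_
  rw [Nat.size_le, Nat.sub_le_iff_le_add, Nat.size_le, Nat.div_lt_iff_lt_mul (by positivity),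
    pow_add]

theorem size_div_two (i : ℕ) : (i / 2).size = i.size - 1 :=
  size_div_two_pow i 1

theorem div_two_pow_size_sub_one {i : ℕ} (hi : i ≠ 0) : i / 2 ^ (i.size - 1) = 1 := by
  have hpos := Nat.size_pos.2 (Nat.pos_of_ne_zero hi)
  refine Nat.div_eq_of_lt_le ?_ ?_
  · rw [one_mul, ← Nat.lt_size]
    omega
  · rw [one_add_one_eq_two, ← pow_succ', Nat.sub_add_cancel hpos]
    exact i.lt_size_self

/-- The parent function of the infinite caterpillar: `(t, 0)` is the `t`-th vertex of its spine, and
the `(t, i)` with `i ≠ 0` form an infinite binary tree hanging off `(t, 0)`, in which `i` has the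
children `2 * i` and `2 * i + 1`. -/
def caterpillarParent : ℕ × ℕ → ℕ × ℕ
  | (t, 0) => (t - 1, 0)
  | (t, i + 1) => (t, (i + 1) / 2)

theorem caterpillarParent_of_ne_zero {t i : ℕ} (hi : i ≠ 0) :
    caterpillarParent (t, i) = (t, i / 2) := by
  obtain ⟨i, rfl⟩ := Nat.exists_eq_succ_of_ne_zero hi
  rfl

theorem caterpillarParent_iterate (t i a : ℕ) :
    caterpillarParent^[a] (t, i) = (t - (a - i.size), i / 2 ^ a) := by
  induction a with
  | zero => simp
  | succ a ih =>
    rw [Function.iterate_succ_apply', ih, pow_succ, ← Nat.div_div_eq_div_mul]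
    have hsize := size_div_two_pow i a
    rcases eq_or_ne (i / 2 ^ a) 0 with h | h
    · rw [h, Nat.size_zero] at hsize
      rw [h, caterpillarParent, Nat.zero_div]
      congr 1
      omega
    · rw [← Nat.pos_iff_ne_zero, ← Nat.size_pos] at h
      rw [caterpillarParent_of_ne_zero (Nat.size_pos.1 h).ne']
      congr 1
      omega

theorem adj_parentGraph_caterpillarParent_iff {t i : ℕ} {y : ℕ × ℕ} :
    (parentGraph caterpillarParent).Adj (t, i) y ↔
      y.1 = t ∧ (i ≠ 0 ∧ y.2 = i / 2 ∨ y.2 ≠ 0 ∧ i = y.2 / 2) ∨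
        i = 0 ∧ y.2 = 0 ∧ (t = y.1 + 1 ∨ y.1 = t + 1) := by
  obtain ⟨s, j⟩ := y
  rw [parentGraph, fromRel_adj]
  cases i <;> cases j <;> simp [caterpillarParent] <;> omega

/-- The depth of a vertex of the infinite caterpillar below the root `(0, 0)`. -/
def caterpillarLevel : ℕ × ℕ → ℕ
  | (t, i) => t + i.size

theorem caterpillarLevel_iterate (x : ℕ × ℕ) (a : ℕ) :
    caterpillarLevel (caterpillarParent^[a] x) = caterpillarLevel x - a := by
  obtain ⟨t, i⟩ := x
  rw [caterpillarParent_iterate, caterpillarLevel, caterpillarLevel, size_div_two_pow]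
  omega

theorem caterpillarLevel_parent (x : ℕ × ℕ) :
    caterpillarLevel (caterpillarParent x) = caterpillarLevel x - 1 :=
  caterpillarLevel_iterate x 1

theorem caterpillarLevel_eq_zero_iff {x : ℕ × ℕ} : caterpillarLevel x = 0 ↔ x = (0, 0) := by
  obtain ⟨t, i⟩ := x
  rw [caterpillarLevel, Nat.add_eq_zero_iff, Nat.size_eq_zero, Prod.mk.injEq]

theorem caterpillarParent_eq_self_iff {x : ℕ × ℕ} :
    caterpillarParent x = x ↔ caterpillarLevel x = 0 := by
  refine ⟨fun h => ?_, fun h => ?_⟩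
  · have := caterpillarLevel_parent x
    rw [h] at this
    omega
  · obtain rfl := caterpillarLevel_eq_zero_iff.1 h
    rfl

theorem caterpillarLevel_parent_lt (x : ℕ × ℕ) (hx : caterpillarParent x ≠ x) :
    caterpillarLevel (caterpillarParent x) < caterpillarLevel x := by
  rw [Ne, caterpillarParent_eq_self_iff] at hx
  have := caterpillarLevel_parent x
  omega

theorem even_caterpillarLevel_iff_of_adj {x y : ℕ × ℕ}
    (hxy : (parentGraph caterpillarParent).Adj x y) :
    Even (caterpillarLevel x) ↔ ¬ Even (caterpillarLevel y) := by
  have hparent : ∀ x, caterpillarParent x ≠ x →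
      (Even (caterpillarLevel x) ↔ ¬ Even (caterpillarLevel (caterpillarParent x))) := by
    intro x hx
    rw [Ne, caterpillarParent_eq_self_iff] at hx
    have := caterpillarLevel_parent x
    rw [Nat.even_iff, Nat.even_iff]
    omega
  obtain ⟨hne, rfl | rfl⟩ := hxy
  · exact hparent x hne.symm
  · rw [hparent y hne, not_not]

theorem caterpillarParent_iterate_ne {x : ℕ × ℕ} {a : ℕ} (ha : a < caterpillarLevel x) :
    caterpillarParent (caterpillarParent^[a] x) ≠ caterpillarParent^[a] x := by
  rw [Ne, caterpillarParent_eq_self_iff, caterpillarLevel_iterate]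
  omega

theorem length_eq_of_isPath_caterpillarParent_of_lt {s t i j : ℕ} (hst : s < t)
    {p : (parentGraph caterpillarParent).Walk (s, i) (t, j)} (hp : p.IsPath) :
    p.length = i.size + j.size + (t - s) := by
  rw [add_assoc]
  refine length_eq_of_iterate_parent_eq caterpillarLevel_parent_lt (fun a ha => ?_)
    (fun b hb => ?_) ?_ ?_ hp
  · exact caterpillarParent_iterate_ne (by rw [caterpillarLevel]; omega)
  · exact caterpillarParent_iterate_ne (by rw [caterpillarLevel]; omega)
  · rw [caterpillarParent_iterate, caterpillarParent_iterate, Nat.sub_self, Nat.sub_zero,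
      Nat.add_sub_cancel_left, Nat.sub_sub_self hst.le, Nat.div_eq_of_lt i.lt_size_self,
      Nat.div_eq_of_lt]
    exact j.lt_size_self.trans_le (Nat.pow_le_pow_right two_pos (Nat.le_add_right _ _))
  · rw [caterpillarParent_iterate, caterpillarParent_iterate]
    refine fun h => ?_
    have := congrArg Prod.fst h
    simp only at this
    omega

theorem length_add_two_le_of_isPath_caterpillarParent {t i j : ℕ} (hi : i ≠ 0) (hj : j ≠ 0)
    {p : (parentGraph caterpillarParent).Walk (t, i) (t, j)} (hp : p.IsPath) :
    p.length + 2 ≤ i.size + j.size := by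
  have hi' := Nat.size_pos.2 (Nat.pos_of_ne_zero hi)
  have hj' := Nat.size_pos.2 (Nat.pos_of_ne_zero hj)
  have : p.length ≤ i.size - 1 + (j.size - 1) := by
    refine length_le_of_iterate_parent_eq caterpillarLevel_parent_lt (fun a ha => ?_)
      (fun b hb => ?_) ?_ hp
    · exact caterpillarParent_iterate_ne (by rw [caterpillarLevel]; omega)
    · exact caterpillarParent_iterate_ne (by rw [caterpillarLevel]; omega)
    · rw [caterpillarParent_iterate, caterpillarParent_iterate, div_two_pow_size_sub_one hi,
        div_two_pow_size_sub_one hj]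
      congr 1
      omega
  omega

end Caterpillar

section FiniteCaterpillar

variable {n : ℕ} {k : ℕ → ℕ}

/-- The vertices `(t, i)` of the infinite caterpillar with `t ≤ n` and `i` of at most `k t` binary
digits, so that the binary tree at the `t`-th spine vertex is cut off at height `k t`. -/
def caterpillarVertices (n : ℕ) (k : ℕ → ℕ) : Finset (ℕ × ℕ) :=
  (Finset.range (n + 1)).biUnion fun t => (Finset.range (2 ^ k t)).image (Prod.mk t)

theorem mem_caterpillarVertices {t i : ℕ} :
    (t, i) ∈ caterpillarVertices n k ↔ t ≤ n ∧ i.size ≤ k t := by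
  simp [caterpillarVertices, Nat.size_le]

/-- The finite caterpillar with spine vertices `0, …, n` in which the `t`-th spine vertex, for
`0 < t < n`, is joined to the root of a perfect binary tree whose leaves are at distance `k t` from
the spine. -/
def caterpillar (n : ℕ) (k : ℕ → ℕ) : SimpleGraph (caterpillarVertices n k) :=
  (parentGraph caterpillarParent).induce (caterpillarVertices n k : Set (ℕ × ℕ))

theorem isTree_caterpillar : (caterpillar n k).IsTree := by
  refine ⟨connected_induce_parentGraph caterpillarLevel_parent_lt (r := (0, 0)) ?_ ?_ ?_,
    (isAcyclic_parentGraph caterpillarLevel_parent_lt).induce _⟩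
  · simp [mem_caterpillarVertices]
  · rintro ⟨t, i⟩ h
    rw [Finset.mem_coe, mem_caterpillarVertices] at h
    rcases eq_or_ne i 0 with rfl | hi
    · rw [Finset.mem_coe, caterpillarParent, mem_caterpillarVertices]
      exact ⟨by omega, Nat.zero_le _⟩
    · rw [Finset.mem_coe, caterpillarParent_of_ne_zero hi, mem_caterpillarVertices, size_div_two]
      omega
  · rintro x - hx
    rw [caterpillarParent_eq_self_iff] at hx
    exact caterpillarLevel_eq_zero_iff.1 hx

variable [(caterpillar n k).LocallyFinite]

theorem degree_caterpillar_eq_card {t i : ℕ} (hx : (t, i) ∈ caterpillarVertices n k)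
    {F : Finset (ℕ × ℕ)}
    (hF : ∀ s j, (s, j) ∈ F ↔ (s ≤ n ∧ j.size ≤ k s) ∧
      (s = t ∧ (i ≠ 0 ∧ j = i / 2 ∨ j ≠ 0 ∧ i = j / 2) ∨
        i = 0 ∧ j = 0 ∧ (t = s + 1 ∨ s = t + 1))) :
    (caterpillar n k).degree ⟨(t, i), hx⟩ = F.card := by
  refine @degree_induce_eq_card _ _ _ ‹_› _ hx _ fun y => ?_
  rw [hF, adj_parentGraph_caterpillarParent_iff, Finset.mem_coe, mem_caterpillarVertices]

theorem degree_caterpillar_eq_one (hk : ∀ t ≤ n, k t = 0 ↔ t = 0 ∨ t = n) (hn : 0 < n) {t i : ℕ}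
    (hx : (t, i) ∈ caterpillarVertices n k) (hi : i.size = k t) :
    (caterpillar n k).degree ⟨(t, i), hx⟩ = 1 := by
  have ht := (mem_caterpillarVertices.1 hx).1
  rcases eq_or_ne i 0 with rfl | hi0
  · rw [Nat.size_zero, eq_comm, hk t ht] at hi
    rcases hi with rfl | rfl
    · rw [degree_caterpillar_eq_card hx (F := {(1, 0)}), Finset.card_singleton]
      grind [Nat.size_eq_zero]
    · rw [degree_caterpillar_eq_card hx (F := {(t - 1, 0)}), Finset.card_singleton]
      grind [Nat.size_eq_zero]
  · rw [degree_caterpillar_eq_card hx (F := {(t, i / 2)}), Finset.card_singleton]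
    grind [size_div_two, Nat.size_eq_zero]

theorem degree_caterpillar_eq_three (hk : ∀ t ≤ n, k t = 0 ↔ t = 0 ∨ t = n) {t i : ℕ}
    (hx : (t, i) ∈ caterpillarVertices n k) (hi : i.size < k t) :
    (caterpillar n k).degree ⟨(t, i), hx⟩ = 3 := by
  have ht := (mem_caterpillarVertices.1 hx).1
  rcases eq_or_ne i 0 with rfl | hi0
  · rw [degree_caterpillar_eq_card hx (F := {(t - 1, 0), (t + 1, 0), (t, 1)})]
    · grind
    · have ht0 : ¬ (t = 0 ∨ t = n) := fun h => hi.ne_bot ((hk t ht).2 h)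
      rw [Nat.size_zero] at hi
      intro s j
      simp only [Finset.mem_insert, Finset.mem_singleton, Prod.mk.injEq]
      constructor
      · rintro (⟨rfl, rfl⟩ | ⟨rfl, rfl⟩ | ⟨rfl, rfl⟩)
        · exact ⟨⟨by omega, Nat.zero_le _⟩, Or.inr ⟨trivial, rfl, by omega⟩⟩
        · exact ⟨⟨by omega, Nat.zero_le _⟩, Or.inr ⟨trivial, rfl, by omega⟩⟩
        · exact ⟨⟨by omega, by simpa⟩, by omega⟩
      · omega
  · rw [degree_caterpillar_eq_card hx (F := {(t, i / 2), (t, 2 * i), (t, 2 * i + 1)})]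
    · grind
    · intro s j
      have hsize := size_div_two j
      have hparent := size_div_two i
      simp only [Finset.mem_insert, Finset.mem_singleton, Prod.mk.injEq]
      constructor
      · rintro (⟨rfl, rfl⟩ | ⟨rfl, rfl⟩ | ⟨rfl, rfl⟩)
        · omega
        · rw [Nat.mul_div_cancel_left i two_pos] at hsize
          omega
        · rw [show (2 * i + 1) / 2 = i by omega] at hsize
          omega
      · omega

theorem isLeafVertex_caterpillar_iff (hk : ∀ t ≤ n, k t = 0 ↔ t = 0 ∨ t = n) (hn : 0 < n)
    {t i : ℕ} (hx : (t, i) ∈ caterpillarVertices n k) :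
    (caterpillar n k).IsLeafVertex ⟨(t, i), hx⟩ ↔ i.size = k t := by
  refine ⟨fun h => ?_, degree_caterpillar_eq_one hk hn hx⟩
  by_contra hne
  have hlt := lt_of_le_of_ne (mem_caterpillarVertices.1 hx).2 hne
  rw [IsLeafVertex, degree_caterpillar_eq_three hk hx hlt] at h
  omega

theorem leavesInOneClass_caterpillar (hk : ∀ t ≤ n, k t = 0 ↔ t = 0 ∨ t = n) (hn : 0 < n)
    (heven : ∀ t ≤ n, Even (t + k t)) : (caterpillar n k).LeavesInOneClass := by
  refine ⟨Coloring.mk (fun x => decide (Even (caterpillarLevel x.1))) fun {x y} hxy => ?_, ?_⟩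
  · rw [Ne, decide_eq_decide, even_caterpillarLevel_iff_of_adj (x := x.1) (y := y.1) hxy]
    exact not_iff_self
  · have hleaf : ∀ x, (caterpillar n k).IsLeafVertex x → Even (caterpillarLevel x.1) := by
      rintro ⟨⟨t, i⟩, hx⟩ h
      rw [isLeafVertex_caterpillar_iff hk hn] at h
      rw [caterpillarLevel, h]
      exact heven t (mem_caterpillarVertices.1 hx).1
    exact fun x y hx hy => decide_eq_decide.2 (iff_of_true (hleaf x hx) (hleaf y hy))

theorem IsSpineProfile.isEvenOneThreeTree_caterpillar {m : ℕ} (hk : IsSpineProfile m n k)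
    (hn : 0 < n) : (caterpillar n k).IsEvenOneThreeTree where
  isTree := isTree_caterpillar
  degree_eq := by
    rintro ⟨⟨t, i⟩, hx⟩
    exact (mem_caterpillarVertices.1 hx).2.eq_or_lt.imp
      (degree_caterpillar_eq_one hk.eq_zero_iff hn hx)
      (degree_caterpillar_eq_three hk.eq_zero_iff hx)
  even := leavesInOneClass_caterpillar hk.eq_zero_iff hn hk.even

theorem IsSpineProfile.not_hasLeafLeafPath_caterpillar {m : ℕ} (hk : IsSpineProfile m n k)
    (hn : 0 < n) (hm : 0 < m) : ¬ (caterpillar n k).HasLeafLeafPath (2 * m) := by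
  rintro ⟨⟨⟨s, i⟩, hx⟩, ⟨⟨t, j⟩, hy⟩, p, hi, hj, hp, hlen⟩
  rw [isLeafVertex_caterpillar_iff hk.eq_zero_iff hn] at hi hj
  have hs := (mem_caterpillarVertices.1 hx).1
  have ht := (mem_caterpillarVertices.1 hy).1
  let e := Embedding.induce (G := parentGraph caterpillarParent)
    (caterpillarVertices n k : Set (ℕ × ℕ))
  obtain ⟨q, hq, hqlen⟩ : ∃ q : (parentGraph caterpillarParent).Walk (s, i) (t, j),
      q.IsPath ∧ q.length = 2 * m :=
    ⟨p.map e.toHom, hp.map e.injective, (p.length_map e.toHom).trans hlen⟩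
  rcases lt_trichotomy s t with hst | rfl | hst
  · rw [length_eq_of_isPath_caterpillarParent_of_lt hst hq, hi, hj] at hqlen
    exact hk.add_ne s t hst ht hqlen
  · rcases Nat.eq_zero_or_pos (k s) with hs0 | hs0
    · rw [hs0, Nat.size_eq_zero] at hi hj
      subst hi hj
      rw [Walk.isPath_iff_nil.1 hq |>.eq_nil, Walk.length_nil] at hqlen
      omega
    · have := length_add_two_le_of_isPath_caterpillarParent (Nat.size_pos.1 (hi ▸ hs0)).ne'
        (Nat.size_pos.1 (hj ▸ hs0)).ne' hq
      have := hk.le s hs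
      omega
  · rw [← Walk.length_reverse, length_eq_of_isPath_caterpillarParent_of_lt hst hq.reverse, hi,
      hj] at hqlen
    exact hk.add_ne t s hst hs hqlen

end FiniteCaterpillar

section PeriodicProfile

/-- One period of the heights, at positions modulo `24`, in the spine profiles for paths of length
`20`. -/
def heightPeriod : List ℕ :=
  [8, 1, 2, 1, 4, 3, 2, 7, 6, 5, 6, 7, 2, 3, 4, 1, 2, 1, 8, 9, 6, 5, 6, 9]

/-- The periodic heights, cut off by height `0` at both ends `0` and `24 * n + 2` of the spine. -/
def periodicHeight (n t : ℕ) : ℕ :=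
  if t = 0 ∨ t = 24 * n + 2 then 0 else heightPeriod.getD (t % 24) 0

theorem heightPeriod_spec (t : ℕ) : 0 < heightPeriod.getD (t % 24) 0 ∧
    heightPeriod.getD (t % 24) 0 ≤ 10 ∧ Even (t + heightPeriod.getD (t % 24) 0) := by
  have hperiod : ∀ r < 24, 0 < heightPeriod.getD r 0 ∧ heightPeriod.getD r 0 ≤ 10 ∧
      (r + heightPeriod.getD r 0) % 2 = 0 := by
    decide
  obtain ⟨hpos, hle, heven⟩ := hperiod (t % 24) (Nat.mod_lt _ (by norm_num))
  exact ⟨hpos, hle, Nat.even_iff.2 (by omega)⟩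

theorem heightPeriod_add_ne {s t : ℕ} (hst : s < t) :
    heightPeriod.getD (s % 24) 0 + heightPeriod.getD (t % 24) 0 + (t - s) ≠ 20 := by
  have hperiod : ∀ r < 24, ∀ d < 20, 0 < d →
      heightPeriod.getD r 0 + heightPeriod.getD ((r + d) % 24) 0 + d ≠ 20 := by
    decide
  rcases lt_or_ge (t - s) 20 with h | h
  · have := hperiod (s % 24) (Nat.mod_lt _ (by norm_num)) (t - s) h (by omega)
    rwa [Nat.mod_add_mod, Nat.add_sub_cancel' hst.le] at this
  · have := (heightPeriod_spec s).1
    omega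

theorem isSpineProfile_periodicHeight (n : ℕ) :
    IsSpineProfile 10 (24 * n + 2) (periodicHeight n) where
  eq_zero_iff t _ := by
    have := (heightPeriod_spec t).1
    grind [periodicHeight]
  le t _ := by
    have := (heightPeriod_spec t).2.1
    grind [periodicHeight]
  even t _ := by
    have := (heightPeriod_spec t).2.2
    grind [periodicHeight]
  add_ne s t hst ht := by
    -- The height at both neighbours `1` and `24 * n + 1` of the ends is `1`, so a violation at an
    -- end would give one at the adjacent position.
    have hone : heightPeriod.getD (1 % 24) 0 = 1 := rfl
    have hone' : heightPeriod.getD ((24 * n + 1) % 24) 0 = 1 := by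
      rw [Nat.mul_add_mod, hone]
    rw [periodicHeight, periodicHeight]
    split_ifs with hs ht' ht'
    · omega
    · obtain rfl : s = 0 := by omega
      rcases eq_or_ne t 1 with rfl | ht1
      · omega
      · have := heightPeriod_add_ne (show 1 < t by omega)
        omega
    · obtain rfl : t = 24 * n + 2 := by omega
      rcases eq_or_ne s (24 * n + 1) with rfl | hs1
      · omega
      · have := heightPeriod_add_ne (show s < 24 * n + 1 by omega)
        omega
    · exact heightPeriod_add_ne hst

theorem strictMono_card_caterpillarVertices_periodicHeight :
    StrictMono fun n => (caterpillarVertices (24 * n + 2) (periodicHeight n)).card := by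
  refine strictMono_nat_of_lt_succ fun n => Finset.card_lt_card (Finset.ssubset_iff_of_subset ?_
    |>.2 ⟨(24 * n + 3, 0), ?_, ?_⟩)
  · rintro ⟨t, i⟩
    rw [mem_caterpillarVertices, mem_caterpillarVertices]
    grind [periodicHeight]
  · rw [mem_caterpillarVertices, Nat.size_zero]
    omega
  · rw [mem_caterpillarVertices]
    omega

end PeriodicProfile

section Iso

variable {V W : Type*} {G : SimpleGraph V} {H : SimpleGraph W} [G.LocallyFinite] [H.LocallyFinite]

theorem isLeafVertex_iso_iff (e : G ≃g H) (v : V) : H.IsLeafVertex (e v) ↔ G.IsLeafVertex v := by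
  rw [IsLeafVertex, IsLeafVertex, e.degree_eq]

theorem isEvenOneThreeTree_of_iso (e : G ≃g H) (h : G.IsEvenOneThreeTree) :
    H.IsEvenOneThreeTree where
  isTree := e.isTree_iff.1 h.isTree
  degree_eq v := by
    have := h.degree_eq (e.symm v)
    rwa [e.symm.degree_eq] at this
  even := by
    obtain ⟨c, hc⟩ := h.even
    exact ⟨c.comp e.symm.toHom, fun u v hu hv =>
      hc _ _ ((isLeafVertex_iso_iff e.symm u).2 hu) ((isLeafVertex_iso_iff e.symm v).2 hv)⟩

theorem hasLeafLeafPath_of_iso (e : G ≃g H) {l : ℕ} (h : G.HasLeafLeafPath l) :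
    H.HasLeafLeafPath l := by
  obtain ⟨u, v, p, hu, hv, hp, rfl⟩ := h
  exact ⟨_, _, p.map e.toHom, (isLeafVertex_iso_iff e u).2 hu, (isLeafVertex_iso_iff e v).2 hv,
    hp.map e.injective, p.length_map _⟩

end Iso

theorem exists_strictMono_order_not_hasLeafLeafPath_twenty :
    ∃ (order : ℕ → ℕ) (T : ∀ n : ℕ, SimpleGraph (Fin (order n)))
        (_ : ∀ n : ℕ, DecidableRel (T n).Adj),
      StrictMono order ∧
        ∀ n : ℕ, (T n).IsEvenOneThreeTree ∧ ¬ (T n).HasLeafLeafPath 20 := by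
  classical
  refine ⟨_, fun n => (caterpillar (24 * n + 2) (periodicHeight n)).overFin (Fintype.card_coe _),
    fun n => Classical.decRel _, strictMono_card_caterpillarVertices_periodicHeight, fun n => ?_⟩
  have hk := isSpineProfile_periodicHeight n
  let e := (caterpillar (24 * n + 2) (periodicHeight n)).overFinIso (Fintype.card_coe _)
  exact ⟨isEvenOneThreeTree_of_iso e (hk.isEvenOneThreeTree_caterpillar (by omega)), fun h =>
    hk.not_hasLeafLeafPath_caterpillar (by omega) (by omega) (hasLeafLeafPath_of_iso e.symm h)⟩

theorem mainTheorem2_general :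
    (∀ d : ℕ, ∃ N₀ : ℕ, ∀ (V : Type*) [Fintype V] (T : SimpleGraph V) [DecidableRel T.Adj],
      T.IsTree → (∀ v, T.degree v ≠ 2) → (∀ v, T.degree v ≤ d) → T.LeavesInOneClass →
        N₀ ≤ Fintype.card V → ∀ m : ℕ, m ≤ 9 → T.HasLeafLeafPath (2 * m)) ∧
    (∃ (order : ℕ → ℕ) (T : ∀ n : ℕ, SimpleGraph (Fin (order n)))
        (_ : ∀ n : ℕ, DecidableRel (T n).Adj),
      StrictMono order ∧
        ∀ n : ℕ, (T n).IsEvenOneThreeTree ∧ ¬ (T n).HasLeafLeafPath 20) :=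
  ⟨fun d => ⟨(d + 1) ^ 60 + 1, fun _ _ _ _ hT hdeg hd hone hcard _ hm =>
    hasLeafLeafPath_two_mul_of_le_nine hT hdeg hd hone hcard hm⟩,
    exists_strictMono_order_not_hasLeafLeafPath_twenty⟩

theorem mainTheorem2 :
    (∃ N₀ : ℕ, ∀ (V : Type*) [Fintype V] (T : SimpleGraph V) [DecidableRel T.Adj],
      T.IsEvenOneThreeTree → N₀ ≤ Fintype.card V →
        ∀ m : ℕ, m ≤ 9 → T.HasLeafLeafPath (2 * m)) ∧
    (∃ (order : ℕ → ℕ) (T : ∀ n : ℕ, SimpleGraph (Fin (order n)))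
        (_ : ∀ n : ℕ, DecidableRel (T n).Adj),
      StrictMono order ∧
        ∀ n : ℕ, (T n).IsEvenOneThreeTree ∧ ¬ (T n).HasLeafLeafPath 20) := by
  obtain ⟨hpaths, hfamily⟩ := mainTheorem2_general
  obtain ⟨N₀, hN₀⟩ := hpaths 3
  exact ⟨⟨N₀, fun V _ T _ hT => hN₀ V T hT.isTree (fun v => by have := hT.degree_eq v; omega)
    (fun v => by have := hT.degree_eq v; omega) hT.even⟩, hfamily⟩
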